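/- Let $n\ge 1$ and let $C_n$ be the cycle on the vertex set $\{1,\dots,n\}$ with edges $\{1,2\},\{2,3\},\dots,\{n-1,n\},\{n,1\}$, taken as a simple graph (so $C_1$ is a single vertex and $C_2$ a single edge). Let $m\ge 1$ and let $a_1,\dots,a_m,b_1,\dots,b_{m-1}$ be integers with $$1\le a_1<b_1\le a_2<b_2\le\cdots\le a_{m-1}<b_{m-1}\le a_m\le n.$$ Let $G$ be the noncrossing cycle-chord graph obtained from $C_n$ by adding the edges $\{a_1,b_1\},\dots,\{a_{m-1},b_{m-1}\},\{a_m,1\}$, again as a simple graph (an edge that is already present, or the degenerate $\{1,1\}$ when $a_m=1$, adds nothing). These chords may share endpoints but do not cross. Then $G$ is $e$-positive: its chromatic symmetric function $$X_G(x_1,x_2,\dots)=\sum_{\kappa}x_{\kappa(1)}x_{\kappa(2)}\cdots x_{\kappa(n)},$$ where $\kappa$ runs over all proper colourings $\kappa:\{1,\dots,n\}\to\{1,2,3,\dots\}$ of $G$, is a linear combination with nonnegative integer coefficients of the products $e_\lambda=e_{\lambda_1}\cdots e_{\lambda_\ell}$ with $\lambda=(\lambda_1,\dots,\lambda_\ell)$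 a partition of $n$, where $e_k=\sum_{i_1<\cdots<i_k}x_{i_1}\cdots x_{i_k}$ is the $k$-th elementary symmetric function. -/

import Mathlib

namespace ChromSymm

/-- The chromatic symmetric function `X_G = ∑_κ ∏_v x_{κ(v)}`, the sum being over all proper
colourings `κ : V → {1, 2, 3, …}`, as a formal power series in `x₁, x₂, x₃, …`: the coefficient
of the monomial `x ^ d` is the (finite) number of proper colourings `κ` with
`∏_v x_{κ(v)} = x ^ d`. -/
noncomputable def chromSymm {V : Type*} [Fintype V] (G : SimpleGraph V) : MvPowerSeries ℕ+ ℤ :=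
  fun d => (Nat.card {κ : G.Coloring ℕ+ // ∑ v, Finsupp.single (κ v) 1 = d} : ℤ)

/-- The elementary symmetric function `e_k = ∑_{i₁ < ⋯ < i_k} x_{i₁} ⋯ x_{i_k}` in `x₁, x₂, …`:
the sum of all squarefree monomials of degree `k`. -/
noncomputable def elem (k : ℕ) : MvPowerSeries ℕ+ ℤ :=
  Set.indicator {d : ℕ+ →₀ ℕ | d.degree = k ∧ ∀ i, d i ≤ 1} (fun _ => 1)

/-- `e_μ = e_{μ₁} e_{μ₂} ⋯ e_{μ_ℓ}` for a partition `μ`. -/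
noncomputable def elemPart {n : ℕ} (μ : n.Partition) : MvPowerSeries ℕ+ ℤ :=
  (μ.parts.map elem).prod

/-- `G` is `e`-positive: `X_G`, which is homogeneous of degree `|V|`, is a linear combination of
the `e_μ`, for `μ` a partition of `|V|`, with nonnegative coefficients. -/
def IsEPositive {V : Type*} [Fintype V] (G : SimpleGraph V) : Prop :=
  ∃ c : (Fintype.card V).Partition → ℤ,
    (∀ μ, 0 ≤ c μ) ∧ chromSymm G = ∑ μ, c μ • elemPart μ

/-- The cycle `C_n` with the `m = k + 1` further edges `{a₁, b₁}, …, {a_{m-1}, b_{m-1}}` and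
`{a_m, 1}`. The vertices `1, …, n` are the elements `0, …, n - 1` of `Fin n`, so that the
vertex `1` is `0 : Fin n`; `a₁, …, a_m` is `a 0, …, a k` and `b₁, …, b_{m-1}` is
`b 0, …, b (k - 1)`. As the graph is simple, an added edge that is already present changes
nothing, and neither does a degenerate one `{1, 1}`. -/
def cycleChord (n : ℕ) [NeZero n] {k : ℕ} (a : Fin (k + 1) → Fin n) (b : Fin k → Fin n) :
    SimpleGraph (Fin n) :=
  SimpleGraph.cycleGraph n ⊔
    SimpleGraph.fromEdgeSet
      (Set.range (fun i : Fin k => s(a i.castSucc, b i)) ∪ {s(a (Fin.last k), 0)})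

end ChromSymm

/-! Transfer matrices indexed by colours. Let D be diagonal with entries x_c. The cycle is cut at
the chord ends into free edges and blocks consisting of a chord with the path it spans; the closing
chord makes the last piece a block too. With finitely many colours, X_G is then the trace of a
product of matrices `ear x l * D`, where a free edge is the case l = 0.

Each factor is positive for two reasons. With E(t) = ∏ (1 + x_c t), walks between distinct colours
c, z have generating function ∏_{i ≠ c,z} (1 + x_i t) / (E - tE') (`walk_eq_coeff`), and 1 / (E -
tE') = 1 / (1 - ∑ (k-1) e_k t^k) is e-positive. What remains are the clique matrices x_z e_b(x ∖
{c,z}). They send the row vectors (x_c e_a(x ∖ x_c))_c to e-positive combinations of such vectors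
(`isPos_clique`).

For distinct nonzero x_c these vectors form a basis over the fraction field, so the trace can be
computed there and is e-positive (`IsPos.trace_mem`). Taking |V| variables suffices, since X_G is
homogeneous of degree |V|. -/

namespace ChromSymm

open Finset

/-! ### Identities for elementary symmetric polynomials -/

section Elementary

variable {σ R : Type*} [CommRing R] (x : σ → R)

/-- The generating function `∏_{i ∈ S} (1 + x_i t)` of the elementary symmetric polynomials. -/
noncomputable def esGen (S : Finset σ) : PowerSeries R :=
  ∏ i ∈ S, (1 + PowerSeries.C (x i) * PowerSeries.X)

/-- The elementary symmetric polynomial of degree `k` in the `x_i`, `i ∈ S`. -/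
noncomputable def es (S : Finset σ) (k : ℕ) : R := PowerSeries.coeff k (esGen x S)

lemma es_eq_sum_powersetCard (S : Finset σ) (k : ℕ) :
    es x S k = ∑ T ∈ S.powersetCard k, ∏ i ∈ T, x i := by
  have h : ∀ T : Finset σ, PowerSeries.coeff k (∏ i ∈ T, (PowerSeries.C (x i) * PowerSeries.X)) =
      if T.card = k then ∏ i ∈ T, x i else 0 := by
    intro T
    rw [prod_mul_distrib, prod_const, ← map_prod, PowerSeries.coeff_C_mul, PowerSeries.coeff_X_pow]
    simp [eq_comm]
  rw [es, esGen, prod_one_add, map_sum, sum_congr rfl fun T _ => h T, ← sum_filter,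
    ← powersetCard_eq_filter]

@[simp] lemma es_zero (S : Finset σ) : es x S 0 = 1 := by
  simp [es_eq_sum_powersetCard]

lemma es_of_card_lt {S : Finset σ} {k : ℕ} (h : S.card < k) : es x S k = 0 := by
  rw [es_eq_sum_powersetCard, powersetCard_eq_empty.2 h, sum_empty]

variable [DecidableEq σ]

lemma esGen_erase {S : Finset σ} {c : σ} (hc : c ∈ S) :
    esGen x S = (1 + PowerSeries.C (x c) * PowerSeries.X) * esGen x (S.erase c) :=
  (mul_prod_erase S _ hc).symm

lemma es_succ {S : Finset σ} {c : σ} (hc : c ∈ S) (k : ℕ) :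
    es x S (k + 1) = es x (S.erase c) (k + 1) + x c * es x (S.erase c) k := by
  rw [es, esGen_erase x hc, add_mul, one_mul, map_add, mul_assoc, PowerSeries.coeff_C_mul,
    mul_comm PowerSeries.X, PowerSeries.coeff_succ_mul_X, es, es]

/-- Each (k+1)-subset T arises once for every c ∈ T. This is the coefficient form of ∑ x_c E(x ∖
x_c) = E'. -/
lemma sum_mul_es_erase (S : Finset σ) (k : ℕ) :
    ∑ c ∈ S, x c * es x (S.erase c) k = (k + 1 : ℕ) * es x S (k + 1) := by
  have h : ∀ c ∈ S, x c * es x (S.erase c) k =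
      ∑ T ∈ S.powersetCard (k + 1), if c ∈ T then ∏ i ∈ T, x i else 0 := by
    intro c hc
    rw [← sum_filter, es_eq_sum_powersetCard, mul_sum]
    refine sum_bij' (fun T _ => insert c T) (fun T _ => T.erase c) ?_ ?_ ?_ ?_ ?_
    · intro T hT
      rw [mem_powersetCard] at hT
      have hcT : c ∉ T := fun h => by simpa using hT.1 h
      simp only [mem_filter, mem_powersetCard, mem_insert_self, and_true]
      exact ⟨insert_subset hc (hT.1.trans (erase_subset _ _)), by rw [card_insert_of_notMem hcT, hT.2]⟩
    · intro T hT
      simp only [mem_filter, mem_powersetCard] at hT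
      rw [mem_powersetCard]
      exact ⟨erase_subset_erase _ hT.1.1, by rw [card_erase_of_mem hT.2, hT.1.2]; rfl⟩
    · intro T hT
      rw [mem_powersetCard] at hT
      exact erase_insert fun h => by simpa using hT.1 h
    · intro T hT
      simp only [mem_filter] at hT
      exact insert_erase hT.2
    · intro T hT
      rw [mem_powersetCard] at hT
      rw [prod_insert fun h => by simpa using hT.1 h]
  rw [sum_congr rfl h, sum_comm, es_eq_sum_powersetCard, mul_sum]
  refine sum_congr rfl fun T hT => ?_
  rw [mem_powersetCard] at hT
  rw [← sum_filter, filter_mem_eq_inter, inter_eq_right.2 hT.1, sum_const, hT.2, nsmul_eq_mul]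

/-- The polarized power sum `∑_c x_c e_a(x ∖ x_c) e_b(x ∖ x_c)`. -/
noncomputable def esPair (S : Finset σ) (a b : ℕ) : R :=
  ∑ c ∈ S, x c * es x (S.erase c) a * es x (S.erase c) b

lemma esPair_comm (S : Finset σ) (a b : ℕ) : esPair x S a b = esPair x S b a :=
  sum_congr rfl fun _ _ => by ring

/-- Expanding (a+1) e_{a+1} e_{b+1} leaves an error term ∑ x_c² e_a e_b that is symmetric in a and
b. It cancels on subtracting the same identity with a and b exchanged. -/
lemma esPair_succ (S : Finset σ) (a b : ℕ) :
    esPair x S a (b + 1) = esPair x S (a + 1) b + ((a : R) - b) * (es x S (a + 1) * es x S (b + 1)) := by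
  have h : ∀ a b, ((a + 1 : ℕ) : R) * es x S (a + 1) * es x S (b + 1) = esPair x S a (b + 1) +
      ∑ c ∈ S, x c * x c * (es x (S.erase c) a * es x (S.erase c) b) := by
    intro a b
    rw [← sum_mul_es_erase, sum_mul, esPair, ← sum_add_distrib]
    refine sum_congr rfl fun c hc => ?_
    rw [es_succ x hc b]
    ring
  have h1 := h a b
  have h2 := h b a
  rw [esPair_comm x S b (a + 1), sum_congr rfl fun c _ => by rw [mul_comm (es x (S.erase c) b)]] at h2
  push_cast at h1 h2
  linear_combination h2 - h1

lemma esPair_eq_sum (S : Finset σ) (a b : ℕ) :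
    esPair x S a b =
      ∑ j ∈ range (b + 1), ((a : R) + b + 1 - 2 * j) * (es x S j * es x S (a + b + 1 - j)) := by
  induction b generalizing a with
  | zero =>
    have h := sum_mul_es_erase x S a
    simp only [esPair, es_zero, mul_one]
    rw [h]
    simp
  | succ b ih =>
    rw [esPair_succ, ih, sum_range_succ _ (b + 1)]
    congr 1
    · refine sum_congr rfl fun j _ => ?_
      rw [show a + 1 + b + 1 - j = a + (b + 1) + 1 - j by omega]
      push_cast; ring
    · rw [show a + (b + 1) + 1 - (b + 1) = a + 1 by omega]
      push_cast; ring

/-- The nonnegative transition weights. -/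
def weight (b i j : ℕ) : ℕ := if j ≤ b then i - j else j - i

/-- Against a symmetric sequence the transition weights are the weights of `esPair_eq_sum`,
truncated to the first half. -/
lemma sum_weight_mul {a b d : ℕ} (f : ℕ → R) (had : a ≤ d) (hda : d ≤ a + 1)
    (hf : ∀ j ≤ b + d, f (b + d - j) = f j) :
    ∑ j ∈ range (b + d + 1), (weight b a j : R) * f j =
      ∑ j ∈ range (min (b + 1) d), ((b : R) + d - 2 * j) * f j := by
  -- The subtraction in `weight` is truncated, so the terms with j ≥ d ≥ a vanish.
  have h1 : ∑ j ∈ range (b + 1), (weight b a j : R) * f j =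
      ∑ j ∈ range (min (b + 1) d), ((a - j : ℕ) : R) * f j := by
    rw [← sum_subset (range_subset_range.2 (min_le_left (b + 1) d))]
    · refine sum_congr rfl fun j hj => ?_
      rw [mem_range] at hj
      rw [weight, if_pos (by omega)]
    · intro j hj hj'
      rw [mem_range] at hj hj'
      rw [weight, if_pos (by omega), show a - j = 0 by omega]
      simp
  -- The indices above b are folded back by j ↦ b + d - j, which fixes the values of f.
  have h2 : ∑ j ∈ range d, (weight b a (b + 1 + j) : R) * f (b + 1 + j) =
      ∑ j ∈ range (min (b + 1) d), ((b + d - a - j : ℕ) : R) * f j := by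
    have h : ∀ j ∈ range d, (weight b a (b + 1 + (d - 1 - j)) : R) * f (b + 1 + (d - 1 - j)) =
        ((b + d - a - j : ℕ) : R) * f j := by
      intro j hj
      rw [mem_range] at hj
      rw [← hf j (by omega), weight, if_neg (by omega),
        show b + 1 + (d - 1 - j) = b + d - j by omega,
        show b + d - j - a = b + d - a - j by omega]
    rw [← sum_range_reflect, sum_congr rfl h]
    refine (sum_subset (range_subset_range.2 (min_le_right (b + 1) d)) fun j hj hj' => ?_).symm
    rw [mem_range] at hj hj'
    rw [show b + d - a - j = 0 by omega]
    simp
  rw [show b + d + 1 = b + 1 + d by ring, sum_range_add, h1, h2, ← sum_add_distrib]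
  refine sum_congr rfl fun j hj => ?_
  rw [mem_range] at hj
  rw [← add_mul, ← Nat.cast_add, show a - j + (b + d - a - j) = b + d - 2 * j by omega,
    Nat.cast_sub (by omega)]
  push_cast; rfl

/-- The same weights serve two consecutive degrees, which is what the splitting off of one variable
z requires below. -/
lemma sum_weight_mul_es (S : Finset σ) {a b d : ℕ} (had : a = d ∨ a = d + 1) :
    ∑ j ∈ range (b + d + 2), (weight b a j : R) * (es x S j * es x S (b + d + 1 - j)) =
      esPair x S d b := by
  have h := sum_weight_mul (R := R) (a := a) (b := b) (d := d + 1)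
    (fun j => es x S j * es x S (b + d + 1 - j)) (by omega) (by omega) (fun j hj => by
      rw [← add_assoc] at hj
      simp only [← add_assoc]
      rw [mul_comm, Nat.sub_sub_self hj])
  rw [← add_assoc] at h
  rw [h]
  rcases le_total b d with hbd | hbd
  · rw [esPair_eq_sum, min_eq_left (by omega)]
    refine sum_congr rfl fun j _ => ?_
    rw [add_comm b d]; push_cast; ring
  · rw [esPair_comm, esPair_eq_sum, min_eq_right (by omega)]
    refine sum_congr rfl fun j _ => ?_
    push_cast; ring

/-- Write y = S ∖ z and split off x_z: both sides become P(a,b) + x_z P(a-1,b), where P is `esPair`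
over y. -/
lemma sum_mul_es_erase_mul_es_erase {S : Finset σ} {z : σ} (hz : z ∈ S) (a b : ℕ) :
    ∑ c ∈ S.erase z, x c * es x (S.erase c) a * es x ((S.erase z).erase c) b =
      ∑ j ∈ range (a + b + 2), (weight b a j : R) * es x S (a + b + 1 - j) *
        es x (S.erase z) j := by
  set y := S.erase z with hy
  have hR : ∑ j ∈ range (a + b + 2), (weight b a j : R) * es x S (a + b + 1 - j) * es x y j =
      ∑ j ∈ range (b + a + 2), (weight b a j : R) * (es x y j * es x y (b + a + 1 - j)) +
        x z * ∑ j ∈ range (b + a + 1), (weight b a j : R) * (es x y j * es x y (b + a - j)) := by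
    rw [show a + b + 2 = b + a + 1 + 1 by ring, sum_range_succ, sum_range_succ _ (b + a + 1), mul_sum,
      add_right_comm (∑ j ∈ range (b + a + 1), _), ← sum_add_distrib]
    congr 1
    · refine sum_congr rfl fun j hj => ?_
      rw [mem_range] at hj
      rw [show a + b + 1 - j = (b + a - j) + 1 by omega, es_succ x hz,
        show b + a + 1 - j = (b + a - j) + 1 by omega]
      ring
    · rw [show a + b + 1 - (b + a + 1) = 0 by omega, show b + a + 1 - (b + a + 1) = 0 by omega,
        es_zero, es_zero]
      ring
  rw [hR, sum_weight_mul_es x y (Or.inl rfl)]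
  -- For a = 0 there is no P(a-1,b), and correspondingly all weights with j ≤ b are 0.
  cases a with
  | zero =>
    rw [sum_eq_zero (s := range (b + 0 + 1)), mul_zero, add_zero, esPair]
    · simp
    · intro j hj
      rw [mem_range] at hj
      rw [weight, if_pos (by omega)]
      simp
  | succ a =>
    have h := sum_weight_mul_es x y (a := a + 1) (b := b) (d := a) (Or.inr rfl)
    simp only [← add_assoc] at h ⊢
    rw [h, esPair, esPair, mul_sum, ← sum_add_distrib]
    refine sum_congr rfl fun c hc => ?_
    have hzc : z ∈ S.erase c := mem_erase.2 ⟨fun h => (mem_erase.1 hc).1 h.symm, hz⟩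
    rw [es_succ x hzc, erase_right_comm]
    ring

end Elementary

/-! ### Generating functions of coloured walks and ears -/

section Walks

variable {σ R : Type*} [Fintype σ] [CommRing R] (x : σ → R)

/-- The semiring of nonnegative combinations of products of elementary symmetric polynomials. -/
noncomputable def posES : Subsemiring R := Subsemiring.closure (Set.range (es x univ))

variable {x} in
lemma es_mem_posES (k : ℕ) : es x univ k ∈ posES x := Subsemiring.subset_closure ⟨k, rfl⟩

variable [DecidableEq σ]

/-- The matrix with entry `0` on the diagonal and `1` off it. -/
def offDiag (σ R : Type*) [DecidableEq σ] [CommRing R] : Matrix σ σ R :=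
  Matrix.of fun c z => if c = z then 0 else 1

/-- The properly coloured walks with `l` inner vertices, by the colours of their ends, which do
not count in the weight. -/
noncomputable def walk (l : ℕ) : Matrix σ σ R :=
  (offDiag σ R * Matrix.diagonal x) ^ l * offDiag σ R

/-- The properly coloured walks with `l` inner vertices and with ends of different colours. -/
noncomputable def ear (l : ℕ) : Matrix σ σ R :=
  Matrix.of fun c z => if c = z then 0 else walk x l c z

/-- `E(t) - t E'(t)`, where `E(t)` is the generating function of the elementary symmetric
polynomials. -/
noncomputable def denom : PowerSeries R :=
  esGen x univ - PowerSeries.X * ∑ c, PowerSeries.C (x c) * esGen x (univ.erase c)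

/-- The inverse of `E(t) - t E'(t)`. -/
noncomputable def denomInv : PowerSeries R := PowerSeries.invOfUnit (denom x) 1

lemma coeff_denom (k : ℕ) :
    PowerSeries.coeff k (denom x) = es x univ k - k * es x univ k := by
  cases k with
  | zero => simp [denom, es]
  | succ k =>
    rw [denom, map_sub, PowerSeries.coeff_succ_X_mul, map_sum]
    simp only [PowerSeries.coeff_C_mul]
    rw [← sum_mul_es_erase]
    rfl

lemma denom_mul_denomInv : denom x * denomInv x = 1 := by
  refine PowerSeries.mul_invOfUnit _ _ ?_
  rw [← PowerSeries.coeff_zero_eq_constantCoeff_apply, coeff_denom]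
  simp

/-- The series 1 - (E - tE') has coefficients (k-1) e_k for k ≥ 1 and no constant term, so its
geometric series is positive. -/
lemma coeff_denomInv_mem (k : ℕ) : PowerSeries.coeff k (denomInv x) ∈ posES x := by
  induction k using Nat.strong_induction_on with
  | _ k ih =>
    have h : denomInv x = 1 + (1 - denom x) * denomInv x := by
      rw [sub_mul, denom_mul_denomInv]; ring
    rw [h, map_add, PowerSeries.coeff_mul]
    refine add_mem ?_ (sum_mem fun p hp => ?_)
    · rw [PowerSeries.coeff_one]
      split_ifs
      · exact one_mem _
      · exact zero_mem _
    · have hp' := mem_antidiagonal.1 hp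
      obtain h0 | ⟨i, hi⟩ : p.1 = 0 ∨ ∃ i, p.1 = i + 1 := by
        cases p.1 <;> simp
      · rw [h0, map_sub, coeff_denom]
        simp
      · refine mul_mem ?_ (ih _ (by omega))
        rw [hi, map_sub, coeff_denom, PowerSeries.coeff_one, if_neg (by omega)]
        have : (0 : R) - (es x univ (i + 1) - ((i + 1 : ℕ) : R) * es x univ (i + 1)) =
            (i : R) * es x univ (i + 1) := by push_cast; ring
        rw [this]
        exact mul_mem (natCast_mem _ _) (es_mem_posES _)

lemma walk_zero : walk x 0 = offDiag σ R := by simp [walk]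

lemma walk_succ_apply (l : ℕ) (c z : σ) :
    walk x (l + 1) c z = ∑ u, x u * walk x l u z - x c * walk x l c z := by
  have h : walk x (l + 1) = offDiag σ R * (Matrix.diagonal x * walk x l) := by
    rw [walk, pow_succ']; simp only [walk, Matrix.mul_assoc]
  rw [h, Matrix.mul_apply, ← sum_erase_eq_sub (mem_univ c)]
  simp only [Matrix.diagonal_mul, offDiag, Matrix.of_apply, ite_mul, zero_mul, one_mul]
  rw [sum_ite, sum_const_zero, zero_add]
  refine sum_congr ?_ fun _ _ => rfl
  ext u
  simp [eq_comm]

theorem walk_eq_coeff [IsDomain R] {c z : σ} (hcz : c ≠ z) (l : ℕ) :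
    walk x l c z = PowerSeries.coeff l (denomInv x * esGen x ((univ.erase z).erase c)) := by
  set P : σ → PowerSeries R := fun u => PowerSeries.mk fun l => walk x l u z with hP
  set s : PowerSeries R := ∑ u, PowerSeries.C (x u) * P u with hs
  -- The first step of a walk goes to any colour but u: sum over all colours, then move the excluded
  -- term to the left.
  have hrec : ∀ u, (1 + PowerSeries.C (x u) * PowerSeries.X) * P u =
      (if u = z then 0 else 1) + PowerSeries.X * s := by
    intro u
    ext l
    rw [add_mul, one_mul, mul_assoc, map_add, map_add, PowerSeries.coeff_C_mul]
    cases l with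
    | zero =>
      simp only [PowerSeries.coeff_zero_X_mul, mul_zero, add_zero, hP, PowerSeries.coeff_mk,
        walk_zero, offDiag, Matrix.of_apply]
      split_ifs <;> simp
    | succ l =>
      simp only [PowerSeries.coeff_succ_X_mul, hs, map_sum, PowerSeries.coeff_C_mul, hP,
        PowerSeries.coeff_mk, walk_succ_apply]
      split_ifs <;> simp [PowerSeries.coeff_one]
  -- Multiplying `hrec` by t x_u E(x ∖ x_u) and summing over u gives a linear equation for s alone.
  have hg : (1 + PowerSeries.X * s) * denom x = esGen x (univ.erase z) := by
    have h1 : esGen x univ * (PowerSeries.X * s) =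
        ∑ u, PowerSeries.X * (PowerSeries.C (x u) * esGen x (univ.erase u)) *
          ((if u = z then 0 else 1) + PowerSeries.X * s) := by
      conv_lhs => rw [hs, mul_sum, mul_sum]
      refine sum_congr rfl fun u _ => ?_
      rw [← hrec u, esGen_erase x (mem_univ u)]
      ring
    have h2 : ∑ u, PowerSeries.X * (PowerSeries.C (x u) * esGen x (univ.erase u)) *
          ((if u = z then 0 else 1) + PowerSeries.X * s) =
        (1 + PowerSeries.X * s) *
          (PowerSeries.X * ∑ c, PowerSeries.C (x c) * esGen x (univ.erase c)) -
        PowerSeries.X * (PowerSeries.C (x z) * esGen x (univ.erase z)) := by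
      clear_value s
      have h := sum_ite_eq' univ z
        fun u => (PowerSeries.X * (PowerSeries.C (x u) * esGen x (univ.erase u)) : PowerSeries R)
      rw [if_pos (mem_univ z)] at h
      rw [eq_sub_iff_add_eq, mul_sum, mul_sum, ← h, ← sum_add_distrib]
      refine sum_congr rfl fun u _ => ?_
      split_ifs <;> ring
    have h3 := esGen_erase x (mem_univ z)
    rw [denom]
    linear_combination h1 + h2 + h3
  have hz : 1 + PowerSeries.X * s = denomInv x * esGen x (univ.erase z) := by
    rw [← hg]
    linear_combination -(1 + PowerSeries.X * s) * denom_mul_denomInv x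
  have hne : (1 + PowerSeries.C (x c) * PowerSeries.X : PowerSeries R) ≠ 0 := by
    intro h
    have := congrArg (PowerSeries.coeff 0) h
    simp at this
  have hfin : P c = denomInv x * esGen x ((univ.erase z).erase c) := by
    refine mul_left_cancel₀ hne ?_
    rw [hrec c, if_neg hcz, hz, esGen_erase x (mem_erase.2 ⟨hcz, mem_univ c⟩)]
    ring
  rw [← hfin, hP, PowerSeries.coeff_mk]

/-- The coloured cliques with `b` vertices besides the two whose colours are recorded; the
second of these counts in the weight, and the order of the `b` others is disregarded. -/
noncomputable def clique (b : ℕ) : Matrix σ σ R :=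
  Matrix.of fun c z => if c = z then 0 else x z * es x ((univ.erase z).erase c) b

theorem ear_mul_diagonal [IsDomain R] (l : ℕ) :
    ear x l * Matrix.diagonal x =
      ∑ p ∈ antidiagonal l, PowerSeries.coeff p.1 (denomInv x) • clique x p.2 := by
  ext c z
  rw [Matrix.mul_diagonal, Matrix.sum_apply, ear, Matrix.of_apply]
  split_ifs with h
  · simp [clique, h]
  · rw [walk_eq_coeff x h, PowerSeries.coeff_mul, sum_mul]
    refine sum_congr rfl fun p _ => ?_
    rw [Matrix.smul_apply, clique, Matrix.of_apply, if_neg h, smul_eq_mul, es]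
    ring

end Walks

/-! ### Positivity in the basis of vectors x_c e_a(x ∖ x_c) -/

section Transition

variable {N : ℕ} {R : Type*} [CommRing R] (x : Fin N → R)

/-- The matrix whose rows are the vectors `(x_c e_a(x ∖ x_c))_c`. -/
noncomputable def pieces : Matrix (Fin N) (Fin N) R :=
  Matrix.of fun a c => x c * es x (univ.erase c) a

/-- Lagrange interpolation: the combination of rows with coefficients (-1)^a x_d^(N-1-a) has entries
x_c ∏_{i ≠ c} (x_d - x_i), nonzero only at c = d. Hence a kernel vector vanishes at every d. -/
theorem det_pieces_ne_zero [IsDomain R] (hinj : Function.Injective x) (h0 : ∀ c, x c ≠ 0) :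
    (pieces x).det ≠ 0 := by
  intro hdet
  obtain ⟨v, hv, hv0⟩ := Matrix.exists_mulVec_eq_zero_iff.2 hdet
  refine hv (funext fun d => ?_)
  have key : ∀ c, ∑ a : Fin N, (-1) ^ (a : ℕ) * es x (univ.erase c) a * x d ^ (N - 1 - a) =
      ∏ i ∈ univ.erase c, (x d - x i) := by
    intro c
    have h := congrArg (Polynomial.eval (x d))
      (Multiset.prod_X_sub_X_eq_sum_esymm (((univ.erase c).val).map x))
    have hN : 0 < N := c.pos
    have hcard : (univ.erase c : Finset (Fin N)).card = N - 1 := by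
      rw [card_erase_of_mem (mem_univ c), card_univ, Fintype.card_fin]
    rw [Multiset.map_map, Polynomial.eval_multiset_prod, Multiset.map_map,
      Polynomial.eval_finsetSum, Multiset.card_map] at h
    simp only [Function.comp_def, Polynomial.eval_sub, Polynomial.eval_X, Polynomial.eval_C] at h
    rw [Finset.prod_eq_multiset_prod, h, card_val, hcard, Nat.sub_add_cancel hN,
      Finset.sum_range]
    refine sum_congr rfl fun a _ => ?_
    rw [es_eq_sum_powersetCard, ← Finset.esymm_map_val, ← mul_assoc, Polynomial.eval_mul,
      Polynomial.eval_mul, Polynomial.eval_C, Polynomial.eval_pow, Polynomial.eval_pow,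
      Polynomial.eval_X, Polynomial.eval_neg, Polynomial.eval_one]
  have hsum : ∑ c, v c * x c * ∏ i ∈ univ.erase c, (x d - x i) = 0 := by
    simp only [← key, mul_sum]
    rw [sum_comm]
    refine sum_eq_zero fun a _ => ?_
    have ha := congrFun hv0 a
    rw [Matrix.mulVec, dotProduct] at ha
    have : ∑ c, v c * x c * ((-1) ^ (a : ℕ) * es x (univ.erase c) a * x d ^ (N - 1 - a)) =
        (-1) ^ (a : ℕ) * x d ^ (N - 1 - a) * ∑ c, pieces x a c * v c := by
      rw [mul_sum]
      refine sum_congr rfl fun c _ => ?_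
      rw [pieces, Matrix.of_apply]; ring
    rw [this, ha]; simp
  rw [sum_eq_single d (fun c _ hc => by
    rw [prod_eq_zero (mem_erase.2 ⟨hc.symm, mem_univ d⟩) (sub_self _), mul_zero]) (by simp)] at hsum
  have hprod : ∏ i ∈ univ.erase d, (x d - x i) ≠ 0 :=
    prod_ne_zero_iff.2 fun i hi => sub_ne_zero.2 fun h => (mem_erase.1 hi).1 (hinj h).symm
  simpa [hprod, h0 d] using hsum

/-- A matrix over the colours is positive if it acts on the vectors `(x_c e_a(x ∖ x_c))_c`
through a matrix whose entries are positive in the elementary symmetric polynomials. -/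
def IsPos (Z : Matrix (Fin N) (Fin N) R) : Prop :=
  ∃ M : Matrix (Fin N) (Fin N) R, (∀ i j, M i j ∈ posES x) ∧ pieces x * Z = M * pieces x

variable {x}

lemma IsPos.one : IsPos x 1 :=
  ⟨1, fun i j => by rw [Matrix.one_apply]; split_ifs; exacts [one_mem _, zero_mem _], by simp⟩

lemma IsPos.mul {Z W : Matrix (Fin N) (Fin N) R} (hZ : IsPos x Z) (hW : IsPos x W) :
    IsPos x (Z * W) := by
  obtain ⟨M, hM, hM'⟩ := hZ
  obtain ⟨M₂, hM₂, hM₂'⟩ := hW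
  refine ⟨M * M₂, fun i j => ?_, ?_⟩
  · rw [Matrix.mul_apply]
    exact sum_mem fun k _ => mul_mem (hM i k) (hM₂ k j)
  · rw [← Matrix.mul_assoc, hM', Matrix.mul_assoc, hM₂', Matrix.mul_assoc]

lemma IsPos.pow {Z : Matrix (Fin N) (Fin N) R} (hZ : IsPos x Z) (l : ℕ) : IsPos x (Z ^ l) := by
  induction l with
  | zero => simpa using IsPos.one
  | succ l ih => rw [pow_succ]; exact ih.mul hZ

lemma IsPos.sum_smul {ι : Type*} {s : Finset ι} {r : ι → R} {Z : ι → Matrix (Fin N) (Fin N) R}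
    (hr : ∀ i ∈ s, r i ∈ posES x) (hZ : ∀ i, IsPos x (Z i)) : IsPos x (∑ i ∈ s, r i • Z i) := by
  choose M hM hM' using hZ
  refine ⟨∑ i ∈ s, r i • M i, fun i j => ?_, ?_⟩
  · rw [Matrix.sum_apply]
    exact sum_mem fun k hk => mul_mem (hr k hk) (hM k i j)
  · simp only [Matrix.mul_sum, Matrix.sum_mul, Matrix.mul_smul, Matrix.smul_mul, hM']

variable (x) in
lemma isPos_clique (b : ℕ) : IsPos x (clique x b) := by
  -- The guard is needed because a + b + 1 - j is truncated and would give e_0 for larger j.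
  refine ⟨Matrix.of fun a j => if (j : ℕ) < a + b + 2 then
    (weight b a j : R) * es x univ (a + b + 1 - j) else 0, fun a j => ?_, ?_⟩
  · rw [Matrix.of_apply]
    split_ifs
    · exact mul_mem (natCast_mem _ _) (es_mem_posES _)
    · exact zero_mem _
  · ext a z
    have h := sum_mul_es_erase_mul_es_erase x (mem_univ z) (a : ℕ) b
    have hcard : (univ.erase z : Finset (Fin N)).card < N := by
      rw [card_erase_of_mem (mem_univ z), card_univ, Fintype.card_fin]
      have := z.pos; omega
    have hL : (pieces x * clique x b) a z = x z *
        ∑ c ∈ univ.erase z, x c * es x (univ.erase c) a * es x ((univ.erase z).erase c) b := by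
      rw [Matrix.mul_apply, ← add_sum_erase _ _ (mem_univ z), mul_sum]
      simp only [clique, pieces, Matrix.of_apply, if_true, mul_zero, zero_add]
      refine sum_congr rfl fun c hc => ?_
      rw [if_neg (mem_erase.1 hc).1]
      ring
    rw [hL, h, Matrix.mul_apply, mul_sum]
    simp only [pieces, Matrix.of_apply]
    rw [← Finset.sum_range fun j : ℕ => (if j < (a : ℕ) + b + 2 then
      (weight b a j : R) * es x univ (a + b + 1 - j) else 0) * (x z * es x (univ.erase z) j)]
    simp only [ite_mul, zero_mul]
    rw [← sum_filter]
    -- Indices j ≥ N have no row in the matrix, but e_j of the N - 1 variables other than x_z is 0.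
    refine (sum_subset_zero_on_sdiff (fun j hj => ?_) (fun j hj => ?_) (fun j hj => ?_)).symm
    · exact mem_range.2 (mem_filter.1 hj).2
    · rw [es_of_card_lt x (k := j), mul_zero, mul_zero]
      simp only [mem_sdiff, mem_filter, mem_range, not_and] at hj
      by_contra hlt
      exact hj.2 (by omega) hj.1
    · ring

variable (x) in
theorem isPos_ear_mul_diagonal [IsDomain R] (l : ℕ) : IsPos x (ear x l * Matrix.diagonal x) := by
  rw [ear_mul_diagonal]
  exact IsPos.sum_smul (fun p _ => coeff_denomInv_mem x p.1) fun p => isPos_clique x p.2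

/-- Z and M are conjugate over the fraction field, so their traces agree; the adjugate replaces the
inverse. -/
theorem IsPos.trace_mem [IsDomain R] (hinj : Function.Injective x) (h0 : ∀ c, x c ≠ 0)
    {Z : Matrix (Fin N) (Fin N) R} (hZ : IsPos x Z) : Z.trace ∈ posES x := by
  obtain ⟨M, hM, h⟩ := hZ
  have hdet := det_pieces_ne_zero x hinj h0
  have : Z.trace = M.trace := by
    refine mul_left_cancel₀ hdet ?_
    have e1 : (pieces x * Z * (pieces x).adjugate).trace = (pieces x).det * Z.trace := by
      rw [Matrix.trace_mul_comm, ← Matrix.mul_assoc, Matrix.adjugate_mul, Matrix.smul_mul,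
        Matrix.one_mul, Matrix.trace_smul, smul_eq_mul]
    have e2 : (M * pieces x * (pieces x).adjugate).trace = (pieces x).det * M.trace := by
      rw [Matrix.mul_assoc, Matrix.mul_adjugate, Matrix.mul_smul, Matrix.mul_one,
        Matrix.trace_smul, smul_eq_mul]
    rw [← e1, ← e2, h]
  rw [this]
  exact sum_mem fun i _ => hM i i

end Transition

/-! ### Summing out the colours along a path -/

section Elimination

variable {σ R : Type*} [CommRing R]

/-- `f` depends only on the colours of `0, …, j`. -/
def DependsUpTo {α : Type*} (j : ℕ) (f : (ℕ → σ) → α) : Prop :=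
  ∀ κ κ' : ℕ → σ, (∀ i ≤ j, κ i = κ' i) → f κ = f κ'

lemma DependsUpTo.mul {j : ℕ} {f g : (ℕ → σ) → R} (hf : DependsUpTo j f) (hg : DependsUpTo j g) :
    DependsUpTo j fun κ => f κ * g κ := fun κ κ' h => by
  change f κ * g κ = f κ' * g κ'
  rw [hf κ κ' h, hg κ κ' h]

variable (R) in
/-- The indicator of the colourings that are proper on the edges `{α i, β i}`, `i < r`. -/
def chordWeight [DecidableEq σ] (α β : ℕ → ℕ) (r : ℕ) (κ : ℕ → σ) : R :=
  ∏ i ∈ range r, offDiag σ R (κ (α i)) (κ (β i))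

lemma chordWeight_succ [DecidableEq σ] (α β : ℕ → ℕ) (r : ℕ) (κ : ℕ → σ) :
    chordWeight R α β (r + 1) κ =
      chordWeight R α β r κ * offDiag σ R (κ (α r)) (κ (β r)) := prod_range_succ _ _

lemma dependsUpTo_chordWeight [DecidableEq σ] {α β : ℕ → ℕ} {r j : ℕ} (hα : ∀ i < r, α i ≤ j)
    (hβ : ∀ i < r, β i ≤ j) : DependsUpTo j (chordWeight R (σ := σ) α β r) := by
  intro κ κ' h
  refine prod_congr rfl fun i hi => ?_
  rw [mem_range] at hi
  rw [h _ (hα i hi), h _ (hβ i hi)]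

variable (z₀ : σ)

/-- Extension of a finite sequence of colours by a constant. -/
def extend {j : ℕ} (κ : Fin j → σ) (i : ℕ) : σ := if h : i < j then κ ⟨i, h⟩ else z₀

variable [Fintype σ]

/-- The sum of `Φ` over all colourings of `0, …, j - 1`, extended by a constant. -/
def colSum (j : ℕ) (Φ : (ℕ → σ) → R) : R := ∑ κ : Fin j → σ, Φ (extend z₀ κ)

lemma colSum_succ (j : ℕ) (Φ : (ℕ → σ) → R) :
    colSum z₀ (j + 1) Φ = colSum z₀ j fun κ => ∑ c, Φ (Function.update κ j c) := by
  rw [colSum, colSum, ← (Fin.snocEquiv fun _ => σ).sum_comp, Fintype.sum_prod_type, sum_comm]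
  refine sum_congr rfl fun κ _ => sum_congr rfl fun c _ => congrArg Φ (funext fun i => ?_)
  rcases lt_trichotomy i j with h | rfl | h
  · rw [Function.update_of_ne h.ne, extend, dif_pos (by omega), extend, dif_pos h,
      Fin.snocEquiv_apply, Fin.snoc, dif_pos h]
    rfl
  · rw [Function.update_self, extend, dif_pos (by omega), Fin.snocEquiv_apply, Fin.snoc,
      dif_neg (by simp)]
    rfl
  · rw [Function.update_of_ne h.ne', extend, dif_neg (by omega), extend, dif_neg (by omega)]

variable [DecidableEq σ]

/-- Summation over the colours of `j + 1, …, j + l`, which enter through a chain of transitions. -/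
lemma colSum_eliminate (T : Matrix σ σ R) (j l : ℕ) (f : (ℕ → σ) → R) (h : (ℕ → σ) → σ → R)
    (hf : DependsUpTo j f) (hh : DependsUpTo j h) :
    colSum z₀ (j + l + 1) (fun κ => f κ * (∏ i ∈ range l, T (κ (j + i)) (κ (j + i + 1))) *
      h κ (κ (j + l))) =
    colSum z₀ (j + 1) fun κ => f κ * ∑ z, (T ^ l) (κ j) z * h κ z := by
  induction l generalizing h with
  | zero => simp [Matrix.one_apply]
  | succ l ih =>
    have e : ∀ κ : ℕ → σ, (∑ c, f (Function.update κ (j + l + 1) c) *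
        (∏ i ∈ range (l + 1), T (Function.update κ (j + l + 1) c (j + i))
          (Function.update κ (j + l + 1) c (j + i + 1))) *
        h (Function.update κ (j + l + 1) c) (Function.update κ (j + l + 1) c (j + l + 1))) =
        f κ * (∏ i ∈ range l, T (κ (j + i)) (κ (j + i + 1))) *
          ∑ c, T (κ (j + l)) c * h κ c := by
      intro κ
      rw [mul_sum]
      refine sum_congr rfl fun c _ => ?_
      have hu : ∀ i ≤ j + l, Function.update κ (j + l + 1) c i = κ i := fun i hi =>
        Function.update_of_ne (by omega) _ _
      have hp : ∏ i ∈ range l, T (Function.update κ (j + l + 1) c (j + i))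
          (Function.update κ (j + l + 1) c (j + i + 1)) =
          ∏ i ∈ range l, T (κ (j + i)) (κ (j + i + 1)) := prod_congr rfl fun i hi => by
        rw [mem_range] at hi
        rw [hu (j + i) (by omega), hu (j + i + 1) (by omega)]
      rw [hf _ κ fun i hi => hu i (by omega), hh _ κ fun i hi => hu i (by omega),
        Function.update_self, prod_range_succ, hp, Function.update_self, hu _ le_rfl]
      ring
    rw [← add_assoc, colSum_succ]
    simp only [e]
    -- The last vertex is summed out and its transition absorbed into h.
    rw [ih (fun κ u => ∑ c, T u c * h κ c) fun κ κ' hκ => by simp only [hh κ κ' hκ]]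
    congr 1
    funext κ
    congr 1
    simp only [mul_sum]
    rw [sum_comm]
    refine sum_congr rfl fun c _ => ?_
    rw [pow_succ, Matrix.mul_apply, sum_mul]
    exact sum_congr rfl fun _ _ => by ring

variable (x : σ → R)

/-- One step along a properly coloured walk. -/
noncomputable def step : Matrix σ σ R := offDiag σ R * Matrix.diagonal x

/-- The weight of a colouring of the path `0, …, j`. -/
noncomputable def pathWeight (j : ℕ) (κ : ℕ → σ) : R :=
  x (κ 0) * ∏ i ∈ range j, step x (κ i) (κ (i + 1))

lemma step_apply (c z : σ) : step x c z = offDiag σ R c z * x z := Matrix.mul_diagonal _ _ _ _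

lemma pathWeight_add (j l : ℕ) (κ : ℕ → σ) :
    pathWeight x (j + l) κ =
      pathWeight x j κ * ∏ i ∈ range l, step x (κ (j + i)) (κ (j + i + 1)) := by
  rw [pathWeight, prod_range_add, ← mul_assoc]; rfl

lemma dependsUpTo_pathWeight (j : ℕ) : DependsUpTo j (pathWeight x j) := by
  intro κ κ' h
  rw [pathWeight, pathWeight, h 0 (Nat.zero_le _)]
  congr 1
  refine prod_congr rfl fun i hi => ?_
  rw [mem_range] at hi
  rw [h i hi.le, h (i + 1) hi]

lemma step_pow_succ (l : ℕ) : step x ^ (l + 1) = walk x l * Matrix.diagonal x := by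
  rw [pow_succ, walk, step, Matrix.mul_assoc]

lemma ear_zero : ear x 0 = offDiag σ R := by
  ext c z
  rw [ear, walk_zero, Matrix.of_apply, offDiag, Matrix.of_apply]
  split_ifs <;> rfl

lemma ear_apply (l : ℕ) (c z : σ) : ear x l c z = walk x l c z * offDiag σ R c z := by
  rw [ear, Matrix.of_apply, offDiag, Matrix.of_apply]
  split_ifs <;> simp

end Elimination

/-! ### The chain of cycles as a trace -/

section Chain

variable {N : ℕ} {R : Type*} [CommRing R] [IsDomain R] (x : Fin N → R) (z₀ : Fin N)

lemma isPos_step : IsPos x (step x) := by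
  rw [step, ← ear_zero x]
  exact isPos_ear_mul_diagonal x 0

lemma le_of_interleaved {α β : ℕ → ℕ} {r : ℕ} (hαβ : ∀ i < r, α i < β i)
    (hβα : ∀ i < r, β i ≤ α (i + 1)) : ∀ i < r, β i ≤ α r := by
  induction r with
  | zero => simp
  | succ r ih =>
    intro i hi
    rcases Nat.lt_succ_iff_lt_or_eq.1 hi with h | rfl
    · have h1 := ih (fun i hi => hαβ i (by omega)) (fun i hi => hβα i (by omega)) i h
      have h2 := hαβ r (by omega)
      have h3 := hβα r (by omega)
      omega
    · exact hβα i (by omega)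

/-- The open chain of cycles on `0, …, j`, closed up by an arbitrary matrix. -/
theorem exists_isPos_colSum {α β : ℕ → ℕ} {r j : ℕ} (hαβ : ∀ i < r, α i < β i)
    (hβα : ∀ i, i + 1 < r → β i ≤ α (i + 1)) (hj : ∀ i < r, β i ≤ j) :
    ∃ Z, IsPos x Z ∧ ∀ Y : Matrix (Fin N) (Fin N) R,
      colSum z₀ (j + 1) (fun κ => pathWeight x j κ * chordWeight R α β r κ * Y (κ j) (κ 0)) =
        (Matrix.diagonal x * (Z * Y)).trace := by
  induction r generalizing j with
  | zero =>
    refine ⟨step x ^ j, (isPos_step x).pow j, fun Y => ?_⟩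
    have h := colSum_eliminate z₀ (step x) 0 j (fun κ => x (κ 0)) (fun κ z => Y z (κ 0))
      (fun κ κ' h => by simp only [h 0 le_rfl]) (fun κ κ' h => by simp only [h 0 le_rfl])
    simp only [zero_add] at h
    simp only [chordWeight, range_zero, prod_empty, mul_one, pathWeight]
    rw [h, colSum_succ]
    simp [colSum, Matrix.trace, Matrix.mul_apply, Matrix.diagonal_apply]
  | succ r ih =>
    obtain ⟨l, hl⟩ : ∃ l, β r = α r + (l + 1) :=
      ⟨β r - α r - 1, by have := hαβ r (by omega); omega⟩
    obtain ⟨m, rfl⟩ : ∃ m, j = α r + (l + 1) + m := ⟨j - β r, by have := hj r (by omega); omega⟩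
    have hβ : ∀ i < r, β i ≤ α r :=
      le_of_interleaved (fun i hi => hαβ i (by omega)) fun i hi => hβα i (by omega)
    have hα : ∀ i < r, α i ≤ α r := fun i hi => (hαβ i (by omega)).le.trans (hβ i hi)
    -- Z does not depend on the closing matrix Y, so everything after α r can be put into Y.
    obtain ⟨Z, hZ, hZY⟩ := ih (j := α r) (fun i hi => hαβ i (by omega))
      (fun i hi => hβα i (by omega)) hβ
    refine ⟨Z * ((ear x l * Matrix.diagonal x) * step x ^ m),
      hZ.mul ((isPos_ear_mul_diagonal x l).mul ((isPos_step x).pow m)), fun Y => ?_⟩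
    have h1 := colSum_eliminate z₀ (step x) (α r + (l + 1)) m
      (fun κ => pathWeight x (α r + (l + 1)) κ * chordWeight R α β (r + 1) κ)
      (fun κ z => Y z (κ 0))
      ((dependsUpTo_pathWeight x _).mul (dependsUpTo_chordWeight (fun i hi => by
        rcases Nat.lt_succ_iff_lt_or_eq.1 hi with h | rfl
        · have := hα i h; omega
        · omega) (fun i hi => by
        rcases Nat.lt_succ_iff_lt_or_eq.1 hi with h | rfl
        · have := hβ i h; omega
        · omega)))
      (fun κ κ' h => by simp only [h 0 (Nat.zero_le _)])
    -- The factor for the last chord turns `step x ^ (l + 1)`, a walk times D, into an ear times D.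
    have h2 := colSum_eliminate z₀ (step x) (α r) (l + 1)
      (fun κ => pathWeight x (α r) κ * chordWeight R α β r κ)
      (fun κ z => offDiag (Fin N) R (κ (α r)) z * (step x ^ m * Y) z (κ 0))
      ((dependsUpTo_pathWeight x _).mul (dependsUpTo_chordWeight hα hβ))
      (fun κ κ' h => by simp only [h 0 (Nat.zero_le _), h (α r) le_rfl])
    have h3 := hZY ((ear x l * Matrix.diagonal x) * (step x ^ m * Y))
    rw [Matrix.mul_assoc Z, Matrix.mul_assoc (ear x l * _), ← h3]
    refine Eq.trans ?_ (h1.trans (Eq.trans ?_ (h2.trans ?_)))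
    · congr 1; funext κ; rw [pathWeight_add]; ring
    · congr 1; funext κ
      rw [pathWeight_add, chordWeight_succ, ← hl, Matrix.mul_apply]
      ring
    · congr 1; funext κ; congr 1
      rw [Matrix.mul_apply]
      refine sum_congr rfl fun z _ => ?_
      rw [step_pow_succ, Matrix.mul_diagonal, Matrix.mul_diagonal, ear_apply]
      ring

/-- The closed chain of cycles on `0, …, m`. -/
theorem colSum_mem_posES (hinj : Function.Injective x) (h0 : ∀ c, x c ≠ 0) {α β : ℕ → ℕ}
    {k m : ℕ} (hαβ : ∀ i < k, α i < β i) (hβα : ∀ i < k, β i ≤ α (i + 1)) (hm : α k ≤ m) :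
    colSum z₀ (m + 1) (fun κ => pathWeight x m κ * chordWeight R α β k κ *
      (offDiag (Fin N) R (κ m) (κ 0) * offDiag (Fin N) R (κ (α k)) (κ 0))) ∈ posES x := by
  obtain ⟨l, rfl⟩ := Nat.exists_eq_add_of_le hm
  have hβ : ∀ i < k, β i ≤ α k := le_of_interleaved hαβ hβα
  have hα : ∀ i < k, α i ≤ α k := fun i hi => (hαβ i hi).le.trans (hβ i hi)
  obtain ⟨Z, hZ, hZY⟩ := exists_isPos_colSum x z₀ hαβ (fun i hi => hβα i (by omega)) hβ
  have h1 := colSum_eliminate z₀ (step x) (α k) l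
    (fun κ => pathWeight x (α k) κ * chordWeight R α β k κ)
    (fun κ z => offDiag (Fin N) R z (κ 0) * offDiag (Fin N) R (κ (α k)) (κ 0))
    ((dependsUpTo_pathWeight x _).mul (dependsUpTo_chordWeight hα hβ))
    (fun κ κ' h => by simp only [h 0 (Nat.zero_le _), h (α k) le_rfl])
  have h2 := hZY (ear x l)
  -- The weight of vertex 0 is rotated to the end of the last ear, formed by the edge {m, 0} and the
  -- chord {α k, 0}.
  have h3 : (Matrix.diagonal x * (Z * ear x l)).trace ∈ posES x := by
    rw [Matrix.trace_mul_comm, Matrix.mul_assoc]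
    exact (hZ.mul (isPos_ear_mul_diagonal x l)).trace_mem hinj h0
  rw [← h2] at h3
  convert h3 using 1
  refine Eq.trans ?_ (h1.trans ?_)
  · congr 1; funext κ; rw [pathWeight_add]; ring
  · congr 1; funext κ; congr 1
    rw [ear_apply, walk, Matrix.mul_apply, sum_mul]
    exact sum_congr rfl fun z _ => by rw [step]; ring

end Chain

/-! ### From finitely many variables to symmetric functions -/

section Coefficients

open Classical in
/-- The sum of the monomials of the proper colourings of `G` with colours in `σ`. -/
noncomputable def colorSum {V σ R : Type*} [Fintype V] [Fintype σ] [CommRing R]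
    (G : SimpleGraph V) (x : σ → R) : R :=
  ∑ κ : V → σ, if ∀ u v, G.Adj u v → κ u ≠ κ v then ∏ v, x (κ v) else 0

lemma coeff_prod_X {ι σ : Type*} [DecidableEq σ] (s : Finset ι) (f : ι → σ) (d : σ →₀ ℕ) :
    MvPowerSeries.coeff d (∏ i ∈ s, (MvPowerSeries.X (f i) : MvPowerSeries σ ℤ)) =
      if ∑ i ∈ s, Finsupp.single (f i) 1 = d then 1 else 0 := by
  have h : ∏ i ∈ s, (MvPowerSeries.X (f i) : MvPowerSeries σ ℤ) =
      MvPowerSeries.monomial (∑ i ∈ s, Finsupp.single (f i) 1) 1 := by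
    induction s using Finset.cons_induction with
    | empty => simp
    | cons a s ha ih =>
      rw [prod_cons, sum_cons, ih, MvPowerSeries.X, MvPowerSeries.monomial_mul_monomial, one_mul]
  rw [h, MvPowerSeries.coeff_monomial]
  simp only [eq_comm]

open Classical in
lemma coeff_elem (k : ℕ) (d : ℕ+ →₀ ℕ) :
    MvPowerSeries.coeff d (elem k) = if d.degree = k ∧ ∀ i, d i ≤ 1 then 1 else 0 := by
  change Set.indicator {d : ℕ+ →₀ ℕ | d.degree = k ∧ ∀ i, d i ≤ 1} (fun _ => (1 : ℤ)) d = _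
  rw [Set.indicator_apply]
  rfl

variable {N : ℕ}

lemma killCompl_elem (s : Fin N ↪ ℕ+) (k : ℕ) :
    MvPowerSeries.killCompl (R := ℤ) s (elem k) = es MvPowerSeries.X univ k := by
  ext d
  rw [MvPowerSeries.coeff_killCompl, es_eq_sum_powersetCard, map_sum]
  refine Eq.trans ?_ (sum_congr rfl fun T _ => (coeff_prod_X T id d).symm)
  simp only [id]
  have hT : ∀ T : Finset (Fin N), ∑ i ∈ T, Finsupp.single i 1 = d ↔
      T = d.support ∧ ∀ i, d i ≤ 1 := by
    intro T
    have hval : ∀ j, (∑ i ∈ T, Finsupp.single i (1 : ℕ)) j = if j ∈ T then 1 else 0 := by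
      intro j
      simp [Finsupp.finsetSum_apply, Finsupp.single_apply]
    constructor
    · rintro rfl
      refine ⟨?_, fun i => ?_⟩
      · ext j
        rw [Finsupp.mem_support_iff, hval]
        simp
      · rw [hval]; split_ifs <;> simp
    · rintro ⟨rfl, h⟩
      ext j
      rw [hval]
      have := h j
      split_ifs with hj
      · rw [Finsupp.mem_support_iff] at hj; omega
      · rw [Finsupp.notMem_support_iff] at hj; omega
  have hcond : (Finsupp.embDomain s d).degree = d.degree := by
    simp [Finsupp.degree_apply, Finsupp.support_embDomain]
  have hle : (∀ i, Finsupp.embDomain s d i ≤ 1) ↔ ∀ i, d i ≤ 1 := by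
    constructor
    · intro h i
      have := h (s i)
      rwa [Finsupp.embDomain_apply_self] at this
    · intro h i
      by_cases hi : i ∈ Set.range s
      · obtain ⟨j, rfl⟩ := hi
        rw [Finsupp.embDomain_apply_self]; exact h j
      · rw [Finsupp.embDomain_of_notMem_range _ _ _ hi]; omega
  simp only [hT]
  rw [coeff_elem]
  simp only [hcond, hle]
  by_cases h : ∀ i, d i ≤ 1
  · have hdeg : d.degree = d.support.card := by
      rw [Finsupp.degree_apply, card_eq_sum_ones]
      refine sum_congr rfl fun i hi => ?_
      have := h i
      rw [Finsupp.mem_support_iff] at hi; omega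
    simp only [h, implies_true, and_true, sum_ite_eq', hdeg, mem_powersetCard, subset_univ, true_and]
  · simp [h]

lemma killCompl_chromSymm {V : Type*} [Fintype V] (G : SimpleGraph V) (s : Fin N ↪ ℕ+) :
    MvPowerSeries.killCompl (R := ℤ) s (chromSymm G) = colorSum G MvPowerSeries.X := by
  classical
  ext d
  rw [MvPowerSeries.coeff_killCompl, colorSum, map_sum]
  trans ∑ κ : V → Fin N, if (∀ u v, G.Adj u v → κ u ≠ κ v) ∧ ∑ v, Finsupp.single (κ v) 1 = d
    then (1 : ℤ) else 0
  swap
  · refine sum_congr rfl fun κ _ => ?_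
    by_cases h : ∀ u v, G.Adj u v → κ u ≠ κ v
    · rw [if_pos h]
      refine Eq.trans ?_ (coeff_prod_X univ κ d).symm
      exact if_congr (and_iff_right h) rfl rfl
    · rw [if_neg h, if_neg fun h' => h h'.1, map_zero]
  rw [sum_boole]
  change ((Nat.card _ : ℕ) : ℤ) = _
  rw [← Fintype.card_subtype, ← Nat.card_eq_fintype_card, Nat.cast_inj]
  have hemb : ∀ κ : V → Fin N, ∑ v, Finsupp.single (s (κ v)) 1 =
      Finsupp.embDomain s (∑ v, Finsupp.single (κ v) (1 : ℕ)) := by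
    intro κ
    simp only [Finsupp.embDomain_eq_mapDomain, Finsupp.mapDomain_finsetSum,
      Finsupp.mapDomain_single]
  symm
  refine Nat.card_eq_of_bijective (fun κ => ⟨SimpleGraph.Coloring.mk (fun v => s (κ.1 v))
    fun {u v} h h' => κ.2.1 u v h (s.injective h'), ?_⟩) ⟨?_, ?_⟩
  · exact (hemb κ.1).trans (congrArg _ κ.2.2)
  · intro κ κ' h
    ext v
    have := congrArg (fun c => c.1 v) h
    exact congrArg Fin.val (s.injective this)
  · rintro ⟨κ, hκ⟩
    -- A colour outside the range of s has exponent 0 in the monomial, yet v contributes 1 to it.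
    have hr : ∀ v, ∃ i, s i = κ v := by
      intro v
      by_contra hv
      have h0 : Finsupp.embDomain s d (κ v) = 0 := Finsupp.embDomain_of_notMem_range _ _ _ hv
      rw [← hκ, Finsupp.finsetSum_apply] at h0
      have := (sum_eq_zero_iff.1 h0) v (mem_univ v)
      simp at this
    choose f hf using hr
    refine ⟨⟨f, fun u v h h' => κ.valid h (by rw [← hf, ← hf, h']), ?_⟩, ?_⟩
    · apply Finsupp.embDomain_injective s
      rw [← hemb, ← hκ]
      simp only [hf]
    · apply Subtype.ext
      apply RelHom.ext
      intro v
      exact hf v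

lemma elem_zero : elem 0 = 1 := by
  classical
  ext d
  rw [MvPowerSeries.coeff_one, coeff_elem]
  refine if_congr ⟨fun h => (Finsupp.degree_eq_zero_iff d).1 h.1, ?_⟩ rfl rfl
  rintro rfl
  simp

lemma coeff_prod_elem_eq_zero (m : Multiset ℕ) {d : ℕ+ →₀ ℕ} (hd : d.degree ≠ m.sum) :
    MvPowerSeries.coeff d (m.map elem).prod = 0 := by
  classical
  induction m using Multiset.induction_on generalizing d with
  | empty =>
    rw [Multiset.map_zero, Multiset.prod_zero, MvPowerSeries.coeff_one, if_neg]
    rintro rfl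
    simp at hd
  | cons k m ih =>
    rw [Multiset.map_cons, Multiset.prod_cons, MvPowerSeries.coeff_mul]
    refine sum_eq_zero fun p hp => ?_
    rw [HasAntidiagonal.mem_antidiagonal] at hp
    by_cases h : p.2.degree = m.sum
    · have : p.1.degree ≠ k := by
        rintro rfl
        rw [← hp, map_add, h, Multiset.sum_cons] at hd
        exact hd rfl
      rw [coeff_elem, if_neg fun h' => this h'.1, zero_mul]
    · rw [ih h, mul_zero]

lemma elemPart_ofSums {n : ℕ} (m : Multiset ℕ) (hm : m.sum = n) :
    elemPart (Nat.Partition.ofSums n m hm) = (m.map elem).prod := by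
  have : ∀ m : Multiset ℕ, ((m.filter fun i => i ≠ 0).map elem).prod = (m.map elem).prod := by
    intro m
    induction m using Multiset.induction_on with
    | empty => simp
    | cons k m ih =>
      by_cases hk : k = 0
      · rw [Multiset.filter_cons_of_neg (p := fun i => i ≠ 0) _ (by simpa using hk), ih, Multiset.map_cons,
          Multiset.prod_cons, hk, elem_zero, one_mul]
      · rw [Multiset.filter_cons_of_pos (p := fun i => i ≠ 0) _ hk, Multiset.map_cons, Multiset.prod_cons, ih,
          Multiset.map_cons, Multiset.prod_cons]
  exact this m

/-- Products of the e_k are homogeneous, so those of degree other than n may be discarded; factors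
e_0 = 1 are dropped. -/
lemma exists_partition_coeff (n : ℕ) {F : MvPowerSeries ℕ+ ℤ}
    (hF : F ∈ Subsemiring.closure (Set.range elem)) :
    ∃ c : n.Partition → ℤ, (∀ μ, 0 ≤ c μ) ∧ ∀ d : ℕ+ →₀ ℕ, d.degree = n →
      MvPowerSeries.coeff d F = MvPowerSeries.coeff d (∑ μ, c μ • elemPart μ) := by
  classical
  rw [Subsemiring.mem_closure_iff] at hF
  induction hF using AddSubmonoid.closure_induction with
  | mem F hF =>
    obtain ⟨l, hl, rfl⟩ := Submonoid.exists_multiset_of_mem_closure hF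
    obtain ⟨m, rfl⟩ : ∃ m : Multiset ℕ, m.map elem = l := by
      clear hF
      induction l using Multiset.induction_on with
      | empty => exact ⟨0, rfl⟩
      | cons f l ih =>
        obtain ⟨m, hm⟩ := ih fun y hy => hl y (Multiset.mem_cons_of_mem hy)
        obtain ⟨k, hk⟩ := hl f (Multiset.mem_cons_self f l)
        exact ⟨k ::ₘ m, by rw [Multiset.map_cons, hk, hm]⟩
    by_cases hm : m.sum = n
    · refine ⟨Pi.single (Nat.Partition.ofSums n m hm) 1, fun μ => ?_, fun d _ => ?_⟩
      · rw [Pi.single_apply]; split_ifs <;> simp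
      · rw [sum_eq_single (Nat.Partition.ofSums n m hm)]
        · rw [Pi.single_eq_same, one_smul, elemPart_ofSums]
        · intro μ _ hμ
          rw [Pi.single_eq_of_ne hμ, zero_smul]
        · simp
    · refine ⟨0, fun μ => le_rfl, fun d hd => ?_⟩
      rw [coeff_prod_elem_eq_zero m (by omega)]
      simp
  | zero => exact ⟨0, fun μ => le_rfl, fun d _ => by simp⟩
  | add F F' _ _ h h' =>
    obtain ⟨c, hc, hcF⟩ := h
    obtain ⟨c', hc', hcF'⟩ := h'
    refine ⟨c + c', fun μ => add_nonneg (hc μ) (hc' μ), fun d hd => ?_⟩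
    rw [map_add, hcF d hd, hcF' d hd, ← map_add, ← sum_add_distrib]
    simp only [Pi.add_apply, add_smul]

/-- One and the same lift works for every choice of N variables, so algebraic independence of the
e_k is not needed. -/
lemma exists_mem_closure_killCompl {f : MvPowerSeries (Fin N) ℤ}
    (hf : f ∈ posES (MvPowerSeries.X : Fin N → MvPowerSeries (Fin N) ℤ)) :
    ∃ F ∈ Subsemiring.closure (Set.range elem),
      ∀ s : Fin N ↪ ℕ+, MvPowerSeries.killCompl s F = f := by
  rw [posES] at hf
  induction hf using Subsemiring.closure_induction with
  | mem f hf =>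
    obtain ⟨k, rfl⟩ := hf
    exact ⟨elem k, Subsemiring.subset_closure ⟨k, rfl⟩, fun s => killCompl_elem s k⟩
  | zero => exact ⟨0, zero_mem _, fun s => map_zero _⟩
  | one => exact ⟨1, one_mem _, fun s => map_one _⟩
  | add f g _ _ hf hg =>
    obtain ⟨F, hF, hFf⟩ := hf
    obtain ⟨F', hF', hFf'⟩ := hg
    exact ⟨F + F', add_mem hF hF', fun s => by rw [map_add, hFf, hFf']⟩
  | mul f g _ _ hf hg =>
    obtain ⟨F, hF, hFf⟩ := hf
    obtain ⟨F', hF', hFf'⟩ := hg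
    exact ⟨F * F', mul_mem hF hF', fun s => by rw [map_mul, hFf, hFf']⟩

lemma exists_embedding_support {n : ℕ} (d : ℕ+ →₀ ℕ) (hd : d.degree = n) :
    ∃ (s : Fin n ↪ ℕ+) (d' : Fin n →₀ ℕ), Finsupp.embDomain s d' = d := by
  have hcard : d.support.card ≤ n := by
    rw [← hd, Finsupp.degree_apply, card_eq_sum_ones]
    exact sum_le_sum fun i hi => Nat.one_le_iff_ne_zero.2 (Finsupp.mem_support_iff.1 hi)
  obtain ⟨S, hS, hSn⟩ := Infinite.exists_superset_card_eq d.support n hcard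
  let e : Fin n ≃ S := (Fintype.equivFinOfCardEq (by rw [Fintype.card_coe, hSn])).symm
  refine ⟨e.toEmbedding.trans (Function.Embedding.subtype _), d.comapDomain _
    (e.toEmbedding.trans (Function.Embedding.subtype _)).injective.injOn, ?_⟩
  refine Finsupp.embDomain_comapDomain fun i hi => ?_
  exact ⟨e.symm ⟨i, hS hi⟩, by simp⟩

/-- A monomial of degree |V| involves at most |V| variables, so its coefficient survives restriction
to suitable |V| of them. -/
theorem isEPositive_of_colorSum_mem {V : Type*} [Fintype V] (G : SimpleGraph V)
    (h : colorSum G (MvPowerSeries.X : Fin (Fintype.card V) → MvPowerSeries _ ℤ) ∈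
      posES (MvPowerSeries.X : Fin (Fintype.card V) → MvPowerSeries _ ℤ)) :
    IsEPositive G := by
  obtain ⟨F, hF, hFG⟩ := exists_mem_closure_killCompl h
  obtain ⟨c, hc, hcF⟩ := exists_partition_coeff (Fintype.card V) hF
  refine ⟨c, hc, ?_⟩
  ext d
  by_cases hd : d.degree = Fintype.card V
  · obtain ⟨s, d', rfl⟩ := exists_embedding_support d hd
    rw [← hcF _ hd, ← MvPowerSeries.coeff_killCompl, ← MvPowerSeries.coeff_killCompl, hFG,
      killCompl_chromSymm]
  · rw [map_sum, sum_eq_zero]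
    · have : IsEmpty {κ : G.Coloring ℕ+ // ∑ v, Finsupp.single (κ v) 1 = d} := by
        refine ⟨fun κ => hd ?_⟩
        rw [← κ.2, map_sum]
        simp
      change ((Nat.card _ : ℕ) : ℤ) = 0
      rw [Nat.card_of_isEmpty, Nat.cast_zero]
    · intro μ _
      rw [map_zsmul, elemPart, coeff_prod_elem_eq_zero _ (by rwa [μ.parts_sum]), smul_zero]

end Coefficients

/-! ### Proper colourings of the cycle-chord graph -/

section Graph

lemma extend_val {σ : Type*} (z₀ : σ) {j : ℕ} (κ : Fin j → σ) (v : Fin j) :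
    extend z₀ κ v = κ v := by
  rw [extend, dif_pos v.2]

lemma prod_offDiag {ι σ R : Type*} [DecidableEq σ] [CommRing R] (s : Finset ι) (f g : ι → σ)
    [Decidable (∀ i ∈ s, f i ≠ g i)] :
    ∏ i ∈ s, offDiag σ R (f i) (g i) = if ∀ i ∈ s, f i ≠ g i then 1 else 0 := by
  split_ifs with h
  · refine prod_eq_one fun i hi => ?_
    rw [offDiag, Matrix.of_apply, if_neg (h i hi)]
  · push Not at h
    obtain ⟨i, hi, h⟩ := h
    refine prod_eq_zero hi ?_
    rw [offDiag, Matrix.of_apply, if_pos h]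

lemma pathWeight_eq {σ R : Type*} [Fintype σ] [DecidableEq σ] [CommRing R] (x : σ → R) (m : ℕ)
    (κ : ℕ → σ) : pathWeight x m κ =
      (∏ i ∈ range m, offDiag σ R (κ i) (κ (i + 1))) * ∏ i ∈ range (m + 1), x (κ i) := by
  simp only [pathWeight, step_apply, prod_mul_distrib]
  rw [prod_range_succ' _ m]
  ring

open Classical in
lemma colorSum_eq {V σ R : Type*} [Fintype V] [DecidableEq V] [Fintype σ] [CommRing R]
    (G : SimpleGraph V) (x : σ → R) : colorSum G x =
      ∑ κ : V → σ, if ∀ u v, G.Adj u v → κ u ≠ κ v then ∏ v, x (κ v) else 0 :=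
  sum_congr (by ext; simp) fun _ _ => rfl

variable {N : ℕ} {R : Type*} [CommRing R] [IsDomain R]

/-- Graphs whose proper colourings are those of a closed chain of cycles. -/
theorem colorSum_mem_posES (x : Fin N → R) (hinj : Function.Injective x) (h0 : ∀ c, x c ≠ 0)
    (z₀ : Fin N) {k m : ℕ} {α β : ℕ → ℕ} (hαβ : ∀ i < k, α i < β i)
    (hβα : ∀ i < k, β i ≤ α (i + 1)) (hm : α k ≤ m) (G : SimpleGraph (Fin (m + 1)))
    (hG : ∀ κ : ℕ → Fin N, (∀ u v : Fin (m + 1), G.Adj u v → κ u ≠ κ v) ↔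
      (∀ i < m, κ i ≠ κ (i + 1)) ∧ (∀ i < k, κ (α i) ≠ κ (β i)) ∧
        κ m ≠ κ 0 ∧ κ (α k) ≠ κ 0) :
    colorSum G x ∈ posES x := by
  classical
  convert colSum_mem_posES x z₀ hinj h0 hαβ hβα hm using 1
  rw [colorSum_eq, colSum]
  refine sum_congr rfl fun κ _ => ?_
  have h := hG (extend z₀ κ)
  simp only [extend_val] at h
  rw [pathWeight_eq, chordWeight, prod_offDiag, prod_offDiag, offDiag, Matrix.of_apply,
    Matrix.of_apply, prod_range fun i => x (extend z₀ κ i)]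
  simp only [extend_val, mem_range]
  by_cases hκ : ∀ u v, G.Adj u v → κ u ≠ κ v
  · obtain ⟨h1, h2, h3, h4⟩ := h.1 hκ
    rw [if_pos hκ, if_pos h1, if_pos h2, if_neg h3, if_neg h4]
    ring
  · rw [if_neg hκ]
    rw [h] at hκ
    split_ifs <;> first | exact absurd ⟨‹_›, ‹_›, ‹_›, ‹_›⟩ hκ | ring

lemma cycleGraph_adj_iff {m : ℕ} (hm : 1 ≤ m) (u v : Fin (m + 1)) :
    (SimpleGraph.cycleGraph (m + 1)).Adj u v ↔
      (u : ℕ) + 1 = v ∨ (v : ℕ) + 1 = u ∨ (u : ℕ) = m ∧ (v : ℕ) = 0 ∨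
        (v : ℕ) = m ∧ (u : ℕ) = 0 := by
  have h : ∀ u v : Fin (m + 1), ((u - v : Fin (m + 1)) : ℕ) = 1 ↔
      (v : ℕ) + 1 = u ∨ (v : ℕ) = m ∧ (u : ℕ) = 0 := by
    intro u v
    have hu := u.2
    have hv := v.2
    rw [Fin.sub_def]
    change (m + 1 - (v : ℕ) + u) % (m + 1) = 1 ↔ _
    rcases le_or_gt (v : ℕ) u with h | h
    · rw [show m + 1 - (v : ℕ) + u = (u - v) + (m + 1) by omega, Nat.add_mod_right,
        Nat.mod_eq_of_lt (by omega)]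
      omega
    · rw [Nat.mod_eq_of_lt (by omega)]
      omega
  rw [SimpleGraph.cycleGraph_adj', h, h]
  tauto

lemma cycleGraph_proper_iff {σ : Type*} {m : ℕ} (hm : 1 ≤ m) (κ : ℕ → σ) :
    (∀ u v : Fin (m + 1), (SimpleGraph.cycleGraph (m + 1)).Adj u v → κ u ≠ κ v) ↔
      (∀ i < m, κ i ≠ κ (i + 1)) ∧ κ m ≠ κ 0 := by
  simp only [cycleGraph_adj_iff hm]
  constructor
  · intro h
    exact ⟨fun i hi => h ⟨i, by omega⟩ ⟨i + 1, by omega⟩ (Or.inl rfl),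
      h ⟨m, by omega⟩ 0 (Or.inr (Or.inr (Or.inl ⟨rfl, rfl⟩)))⟩
  · rintro ⟨h1, h2⟩ u v (h | h | ⟨h, h'⟩ | ⟨h, h'⟩)
    · rw [← h]; exact h1 u (by omega)
    · rw [← h]; exact (h1 v (by omega)).symm
    · rw [h, h']; exact h2
    · rw [h, h']; exact h2.symm

lemma sup_fromEdgeSet_proper_iff {V σ : Type*} (G : SimpleGraph V) (s : Set (Sym2 V)) (κ : V → σ) :
    (∀ u v, (G ⊔ SimpleGraph.fromEdgeSet s).Adj u v → κ u ≠ κ v) ↔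
      (∀ u v, G.Adj u v → κ u ≠ κ v) ∧ ∀ u v, u ≠ v → s(u, v) ∈ s → κ u ≠ κ v := by
  simp only [SimpleGraph.sup_adj, SimpleGraph.fromEdgeSet_adj]
  exact ⟨fun h => ⟨fun u v h' => h u v (Or.inl h'), fun u v hne h' => h u v (Or.inr ⟨h', hne⟩)⟩,
    fun h u v h' => h'.elim (h.1 u v) fun h' => h.2 u v h'.2 h'.1⟩

theorem cycleChord_colorSum_mem_posES (x : Fin N → R) (hinj : Function.Injective x)
    (h0 : ∀ c, x c ≠ 0) (z₀ : Fin N) {m k : ℕ} (a : Fin (k + 1) → Fin (m + 1))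
    (b : Fin k → Fin (m + 1)) (hab : ∀ i : Fin k, a i.castSucc < b i)
    (hba : ∀ i : Fin k, b i ≤ a i.succ) : colorSum (cycleChord (m + 1) a b) x ∈ posES x := by
  classical
  -- For a single vertex the edge {m, 0} would be a loop, and X_G = e_1.
  rcases Nat.eq_zero_or_pos m with rfl | hm
  · have h : colorSum (cycleChord (0 + 1) a b) x = es x univ 1 := by
      rw [es_eq_sum_powersetCard, powersetCard_one, sum_map, colorSum_eq,
        ← (Equiv.funUnique (Fin 1) (Fin N)).symm.sum_comp]
      refine sum_congr rfl fun c _ => ?_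
      rw [if_pos fun u v h => absurd (Fin.ext (by omega)) h.ne]
      simp
    rw [h]
    exact es_mem_posES 1
  by_cases hlast : a (Fin.last k) = 0
  · obtain rfl : k = 0 := by
      by_contra hk
      obtain ⟨k, rfl⟩ := Nat.exists_eq_succ_of_ne_zero hk
      have h1 := hab (Fin.last k)
      have h2 := hba (Fin.last k)
      rw [Fin.succ_last, hlast] at h2
      exact absurd (h1.trans_le h2) (Fin.not_lt_zero _)
    -- The degenerate chord {0, 0} is replaced by {m, 0}, which is already an edge of the cycle.
    refine colorSum_mem_posES x hinj h0 z₀ (k := 0) (α := fun _ => m) (β := fun _ => m)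
      (by simp) (by simp) le_rfl _ fun κ => ?_
    rw [cycleChord, sup_fromEdgeSet_proper_iff _ _ fun u : Fin (m + 1) => κ u,
      cycleGraph_proper_iff hm, hlast]
    have : ∀ u v : Fin (m + 1), u ≠ v → s(u, v) ∈ Set.range (fun i : Fin 0 =>
        s(a i.castSucc, b i)) ∪ {s(0, 0)} → κ u ≠ κ v := by
      rintro u v hne (⟨i, -⟩ | h)
      · exact i.elim0
      · simp only [Set.mem_singleton_iff, Sym2.eq_iff, or_self] at h
        exact absurd (h.1.trans h.2.symm) hne
    rw [and_iff_left this]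
    simp
  · let α : ℕ → ℕ := fun i => if h : i < k + 1 then a ⟨i, h⟩ else 0
    let β : ℕ → ℕ := fun i => if h : i < k then b ⟨i, h⟩ else 0
    have hα : ∀ i : Fin (k + 1), α i = a i := fun i => dif_pos i.2
    have hβ : ∀ i : Fin k, β i = b i := fun i => dif_pos i.2
    have hk : α k = a (Fin.last k) := hα (Fin.last k)
    refine colorSum_mem_posES x hinj h0 z₀ (k := k) (α := α) (β := β) (fun i hi => ?_)
      (fun i hi => ?_) (hk ▸ Nat.lt_succ_iff.1 (a (Fin.last k)).2) _ fun κ => ?_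
    · have := hab ⟨i, hi⟩
      rw [Fin.lt_def, ← hβ, ← hα] at this
      exact this
    · have := hba ⟨i, hi⟩
      rw [Fin.le_def, ← hβ, ← hα] at this
      exact this
    rw [cycleChord, sup_fromEdgeSet_proper_iff _ _ fun u : Fin (m + 1) => κ u,
      cycleGraph_proper_iff hm, hk]
    have : (∀ u v : Fin (m + 1), u ≠ v → s(u, v) ∈ Set.range (fun i : Fin k =>
        s(a i.castSucc, b i)) ∪ {s(a (Fin.last k), 0)} → κ u ≠ κ v) ↔
        (∀ i < k, κ (α i) ≠ κ (β i)) ∧ κ (a (Fin.last k)) ≠ κ 0 := by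
      constructor
      · intro h
        refine ⟨fun i hi => ?_, h _ 0 hlast (Or.inr rfl)⟩
        have := h _ _ (hab ⟨i, hi⟩).ne (Or.inl ⟨⟨i, hi⟩, rfl⟩)
        rw [← hβ, ← hα] at this
        exact this
      · rintro ⟨h1, h2⟩ u v - (⟨i, hi⟩ | h)
        · have := h1 i i.2
          rw [hβ, show α i = a i.castSucc from hα i.castSucc] at this
          rcases Sym2.eq_iff.1 hi with ⟨rfl, rfl⟩ | ⟨rfl, rfl⟩
          exacts [this, this.symm]
        · rcases Sym2.eq_iff.1 h with ⟨rfl, rfl⟩ | ⟨rfl, rfl⟩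
          exacts [h2, h2.symm]
    rw [this]
    tauto

end Graph

end ChromSymm

theorem mainTheorem5 (n : ℕ) [NeZero n] (k : ℕ) (a : Fin (k + 1) → Fin n) (b : Fin k → Fin n)
    (hab : ∀ i : Fin k, a i.castSucc < b i) (hba : ∀ i : Fin k, b i ≤ a i.succ) :
    ChromSymm.IsEPositive (ChromSymm.cycleChord n a b) := by
  obtain ⟨m, rfl⟩ := Nat.exists_eq_succ_of_ne_zero (NeZero.ne n)
  apply ChromSymm.isEPositive_of_colorSum_mem
  have : IsDomain (MvPowerSeries (Fin (Fintype.card (Fin m.succ))) ℤ) :=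
    NoZeroDivisors.to_isDomain _
  refine ChromSymm.cycleChord_colorSum_mem_posES _ (fun i j h => ?_) (fun c h => ?_)
    (Fin.cast (Fintype.card_fin _).symm 0) a b hab hba
  · exact MvPowerSeries.X_inj.1 h
  · have := congrArg (MvPowerSeries.coeff (Finsupp.single c 1)) h
    rw [MvPowerSeries.coeff_index_single_self_X, map_zero] at this
    exact one_ne_zero this
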